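/- Let $(X,d)$ and $(Y,\delta)$ be non-empty separable complete metric spaces, let $p,q\in[1,+\infty)$ and $C>0$, and suppose that $X$ satisfies the following condition $\mathrm{link}(C)$: for every $\varepsilon>0$ there is $N\ge 1$ such that any $u,v\in X$ with $d(u,v)<C$ admit $r_0,\dots,r_N\in X$ with $r_0=u$, $r_N=v$ and $d(r_{i-1},r_i)<\varepsilon$ for $1\le i\le N$. Notation. For metric spaces $(Z_n,d_n)$, $n\in\mathbb N$, and $r\ge 1$, let $E((Z_n)_{n};r)$ be the equivalence relation on $\prod_n Z_n$ (with the product topology) given by $(x,y)\in E((Z_n)_n;r)\iff\sum_n d_n(x(n),y(n))^r<+\infty$; write $E(Z;r)$ if $Z_n=Z$ for all $n$. For a separable complete metric space $Z$, let $F(Z;r)=E((F_n)_n;r)$, where $F_0\subseteq F_1\subseteq\cdots$ is any sequence of non-empty finite subsets of $Z$ with $\bigcup_n F_n$ dense in $Z$ (the assertion below holds for every choice of such sequences in $X$ and in $Y$). For $y^*\in Y^{\mathbb N}$, let $\ell_q(Y,y^*)$ be the set of $y\in Y^{\mathbb N}$ with $\sum_n\delta(y(n),y^*(n))^q<+\infty$,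 with the metric $\delta_q(x,y)=\left(\sum_n\delta(x(n),y(n))^q\right)^{1/q}$. For $\alpha>0$, $X$ can $C$-finitely Hölder$(\alpha)$ embed into a metric space $(X',d')$ if there are $A,D>0$ such that for every finite $F\subseteq X$ there is $T_F:F\to X'$ with, for all $u,v\in F$: (1) if $d(u,v)\ge C$ then $d'(T_F(u),T_F(v))\ge D$; (2) if $d(u,v)<C$ then $A^{-1}d(u,v)^\alpha\le d'(T_F(u),T_F(v))\le A\,d(u,v)^\alpha$. For relations $R$ on a space $P$ and $S$ on a space $Q$, $R\le_B S$ means that there is a Borel map $\theta:P\to Q$ with $(x,y)\in R\iff(\theta(x),\theta(y))\in S$ for all $x,y\in P$. Then the following conditions are equivalent: (a) $X$ can $C$-finitely Hölder$(p/q)$ embed into $\ell_q(Y,y^*)$ for some $y^*\in Y^{\mathbb N}$; (b) $F(X;p)\le_B E(Y;q)$; (c) $F(X;p)\le_B F(Y;q)$. -/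

import Mathlib

/-- `E` is Borel reducible to `F`: there is a map `θ`, measurable for the Borel σ-algebras of the
two topologies, with `E x y ↔ F (θ x) (θ y)` for all `x, y`. -/
def BorelReducible {α β : Type*} [TopologicalSpace α] [TopologicalSpace β]
    (E : α → α → Prop) (F : β → β → Prop) : Prop :=
  ∃ θ : α → β, @Measurable α β (borel α) (borel β) θ ∧ ∀ x y, E x y ↔ F (θ x) (θ y)

/-- The `ℓ_p`-like relation `E((X_n)_n; p)` on `∏ n, X n`: `∑ d(x n, y n) ^ p < ∞`
(the terms are non-negative, so this is summability). -/
def lpRel (X : ℕ → Type*) [∀ n, PseudoMetricSpace (X n)] (p : ℝ) (x y : ∀ n, X n) : Prop :=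
  Summable fun n => dist (x n) (y n) ^ p

/-- An increasing sequence of (non-empty) finite subsets of `X` with dense union. -/
structure IsFiniteExhaustion {X : Type*} [TopologicalSpace X] (F : ℕ → Set X) : Prop where
  finite : ∀ n, (F n).Finite
  nonempty : (F 0).Nonempty
  mono : Monotone F
  dense : Dense (⋃ n, F n)

/-- The relation `F(X; p) = E((F_n)_n; p)`, computed from the finite exhaustion `F` of `X`;
each `F n` carries the metric of `X`, and `∏ n, F n` the product topology. -/
def finRel {X : Type*} [PseudoMetricSpace X] (F : ℕ → Set X) (p : ℝ) :
    (∀ n, F n) → (∀ n, F n) → Prop :=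
  lpRel (fun n => F n) p

/-- The condition link(C). -/
def Link (X : Type*) [PseudoMetricSpace X] (C : ℝ) : Prop :=
  ∀ ε : ℝ, 0 < ε → ∃ N : ℕ, 1 ≤ N ∧ ∀ u v : X, dist u v < C →
    ∃ r : ℕ → X, r 0 = u ∧ r N = v ∧ ∀ i < N, dist (r i) (r (i + 1)) < ε

/-- `X` can `C`-finitely Hölder(`α`) embed into `X'`. -/
def FinitelyHolderEmbeds (X X' : Type*) [PseudoMetricSpace X] [PseudoMetricSpace X']
    (C α : ℝ) : Prop :=
  ∃ A D : ℝ, 0 < A ∧ 0 < D ∧ ∀ F : Set X, F.Finite → ∃ T : F → X', ∀ u v : F,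
    (C ≤ dist u v → D ≤ dist (T u) (T v)) ∧
    (dist u v < C →
      A⁻¹ * dist u v ^ α ≤ dist (T u) (T v) ∧ dist (T u) (T v) ≤ A * dist u v ^ α)

/-- The underlying set of `ℓ_q((Y_n)_n, y*)`. -/
def LqSpace (Y : ℕ → Type*) [∀ n, PseudoMetricSpace (Y n)] (ystar : ∀ n, Y n) (q : ℝ) :=
  {y : ∀ n, Y n // Summable fun n => dist (y n) (ystar n) ^ q}

namespace LqSpace

variable {Y : ℕ → Type*} [∀ n, PseudoMetricSpace (Y n)] {ystar : ∀ n, Y n} {q : ℝ}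

theorem summable_and_dist_le (hq : 1 ≤ q) (x y z : ∀ n, Y n)
    (hxy : Summable fun n => dist (x n) (y n) ^ q)
    (hyz : Summable fun n => dist (y n) (z n) ^ q) :
    (Summable fun n => dist (x n) (z n) ^ q) ∧
      (∑' n, dist (x n) (z n) ^ q) ^ (1 / q) ≤
        (∑' n, dist (x n) (y n) ^ q) ^ (1 / q) + (∑' n, dist (y n) (z n) ^ q) ^ (1 / q) := by
  obtain ⟨h1, h2⟩ := Real.Lp_add_le_tsum_of_nonneg hq (fun n => dist_nonneg)
    (fun n => dist_nonneg) hxy hyz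
  have hle : ∀ n, dist (x n) (z n) ^ q ≤ (dist (x n) (y n) + dist (y n) (z n)) ^ q := fun n =>
    Real.rpow_le_rpow dist_nonneg (dist_triangle _ _ _) (by linarith)
  have hs : Summable fun n => dist (x n) (z n) ^ q :=
    Summable.of_nonneg_of_le (fun n => Real.rpow_nonneg dist_nonneg _) hle h1
  refine ⟨hs, le_trans ?_ h2⟩
  exact Real.rpow_le_rpow (tsum_nonneg fun n => Real.rpow_nonneg dist_nonneg _)
    (hs.tsum_le_tsum hle h1) (by positivity)

theorem summable_dist (hq : 1 ≤ q) (x y : LqSpace Y ystar q) :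
    Summable fun n => dist (x.1 n) (y.1 n) ^ q :=
  (summable_and_dist_le hq x.1 ystar y.1 x.2 (by simpa only [dist_comm] using y.2)).1

/-- `δ_q(x, y) = (∑ δ_n(x n, y n) ^ q) ^ (1 / q)`. -/
noncomputable instance : Dist (LqSpace Y ystar q) :=
  ⟨fun x y => (∑' n, dist (x.1 n) (y.1 n) ^ q) ^ (1 / q)⟩

noncomputable instance [hq : Fact (1 ≤ q)] : PseudoMetricSpace (LqSpace Y ystar q) where
  dist_self x := by
    have h0 : q ≠ 0 := by linarith [hq.out]
    change (∑' n, dist (x.1 n) (x.1 n) ^ q) ^ (1 / q) = 0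
    simp [Real.zero_rpow h0, h0]
  dist_comm x y := by
    change (∑' n, dist (x.1 n) (y.1 n) ^ q) ^ (1 / q) = (∑' n, dist (y.1 n) (x.1 n) ^ q) ^ (1 / q)
    simp only [dist_comm]
  dist_triangle x y z :=
    (summable_and_dist_le hq.out x.1 y.1 z.1 (summable_dist hq.out x y)
      (summable_dist hq.out y z)).2

end LqSpace

/-! (a) ⇒ (c): code `x n` by its image under the embedding of `F n`, truncated and moved into one
finite member of the exhaustion of `Y`, with disjoint sets of coordinates for different `n`. Below
distance `C` the Hölder bounds make `d ^ p` and `δ_q ^ q` comparable. If either series converges its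
terms tend to `0`, and then only finitely many distances are at least `C`: by size on one side, by
the lower bound `D` on the other. (c) ⇒ (b) is an inclusion.

(b) ⇒ (a) has two stages. First, Baire category makes a reduction `θ` local
(`exists_generic_windows`, `exists_blockwise_reduction`): freeze all coordinates to a generic
sequence except a sparse set `n j`, separated by long frozen windows. Up to summable errors, the
`j`-th block of `θ` then depends on the `j`-th free coordinate only. This gives `f j u v`, a finite
sum of `q`-th powers of distances, such that `∑ d ^ p` and `∑ f j` converge for the same pairs.

Second, this equivalence forces uniform comparability. If an estimate between `d ^ p` and `f j`
failed, repeating each bad pair suitably often would make one series converge and the other diverge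
(`false_of_repeated_pairs`). The upper estimate needs a prior bound on `f j`, obtained by chaining
with link(C). A finite subset of `X` is finally approximated by points of `⋃ n, F n` and embedded by
one block with `j` large. -/

open Filter Topology Set

/-! ### Borel maps on products of finite discrete spaces -/

/-- A Borel map into a second countable space is continuous on a residual set. -/
theorem exists_mem_residual_continuousOn {Z W : Type*} [TopologicalSpace Z] [TopologicalSpace W]
    [SecondCountableTopology W] {θ : Z → W} (hθ : @Measurable Z W (borel Z) (borel W) θ) :
    ∃ R ∈ residual Z, ContinuousOn θ R := by
  borelize Z W
  have hB := TopologicalSpace.isBasis_countableBasis W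
  have hU : ∀ b ∈ TopologicalSpace.countableBasis W, ∃ u : Set Z, IsOpen u ∧ θ ⁻¹' b =ᵇ u :=
    fun b hb => (hθ (hB.isOpen hb).measurableSet).residualEq_isOpen
  choose! U hUo hUe using hU
  refine ⟨{x | ∀ b ∈ TopologicalSpace.countableBasis W, x ∈ θ ⁻¹' b ↔ x ∈ U b}, ?_, ?_⟩
  · exact (eventually_countable_ball (TopologicalSpace.countable_countableBasis W)).2
      fun b hb => (hUe b hb).mem_iff
  · intro x hx
    refine (hB.nhds_hasBasis.tendsto_right_iff).2 fun b ⟨hb, hxb⟩ => ?_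
    have hxU : x ∈ U b := (hx b hb).1 hxb
    filter_upwards [mem_nhdsWithin_of_mem_nhds ((hUo b hb).mem_nhds hxU), self_mem_nhdsWithin]
      with y hy hyR
    exact (hyR b hb).2 hy

/-! ### Changing a finite prefix of a sequence -/

section Prefix

variable {E : ℕ → Type*}

/-- The sequence `x` with its first `k` entries replaced by `r`. -/
def replacePrefix (k : ℕ) (r : ∀ i : Fin k, E i) (x : ∀ i, E i) : ∀ i, E i :=
  fun i => if h : i < k then r ⟨i, h⟩ else x i

theorem replacePrefix_of_lt {k : ℕ} (r : ∀ i : Fin k, E i) (x : ∀ i, E i) {i : ℕ} (h : i < k) :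
    replacePrefix k r x i = r ⟨i, h⟩ := dif_pos h

theorem replacePrefix_of_le {k : ℕ} (r : ∀ i : Fin k, E i) (x : ∀ i, E i) {i : ℕ} (h : k ≤ i) :
    replacePrefix k r x i = x i := dif_neg (not_lt.2 h)

theorem replacePrefix_eq {k : ℕ} {x y : ∀ i, E i} (h : ∀ i, k ≤ i → x i = y i) :
    replacePrefix k (fun i => x i) y = x := by
  funext i
  rcases lt_or_ge i k with hi | hi
  · exact replacePrefix_of_lt _ _ hi
  · rw [replacePrefix_of_le _ _ hi, h i hi]

theorem replacePrefix_replacePrefix {k : ℕ} (r s : ∀ i : Fin k, E i) (x : ∀ i, E i) :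
    replacePrefix k r (replacePrefix k s x) = replacePrefix k r x := by
  funext i
  rcases lt_or_ge i k with hi | hi
  · simp only [replacePrefix_of_lt _ _ hi]
  · simp only [replacePrefix_of_le _ _ hi]

variable [∀ n, TopologicalSpace (E n)]

theorem continuous_replacePrefix (k : ℕ) (r : ∀ i : Fin k, E i) :
    Continuous (replacePrefix k r) := by
  refine continuous_pi fun i => ?_
  rcases lt_or_ge i k with hi | hi
  · simp only [replacePrefix_of_lt _ _ hi]
    exact continuous_const
  · simp only [replacePrefix_of_le _ _ hi]
    exact continuous_apply i

variable [∀ n, DiscreteTopology (E n)]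

theorem exists_cylinder_subset_of_mem_nhds {x : ∀ i, E i} {s : Set (∀ i, E i)} (hs : s ∈ 𝓝 x) :
    ∃ n, PiNat.cylinder x n ⊆ s := by
  obtain ⟨t, ⟨y, n, rfl⟩, hx, hts⟩ := (PiNat.isTopologicalBasis_cylinders E).mem_nhds_iff.1 hs
  exact ⟨n, (PiNat.mem_cylinder_iff_eq.1 hx).symm ▸ hts⟩

/-- A point near the image of `x` already has prefix `r`, and giving it the prefix of `x` produces a
preimage near `x`. Openness is what makes preimages of residual sets residual. -/
theorem isOpenMap_replacePrefix (k : ℕ) (r : ∀ i : Fin k, E i) :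
    IsOpenMap (replacePrefix k r) := by
  rw [isOpenMap_iff_nhds_le]
  intro x s hs
  obtain ⟨n, hn⟩ := exists_cylinder_subset_of_mem_nhds hs
  refine mem_of_superset ((PiNat.isOpen_cylinder E (replacePrefix k r x) (max k n)).mem_nhds
    (PiNat.self_mem_cylinder _ _)) fun y hy => ?_
  rw [PiNat.mem_cylinder_iff] at hy
  have hyr : replacePrefix k r (replacePrefix k (fun i => x i) y) = y := by
    rw [replacePrefix_replacePrefix]
    funext i
    rcases lt_or_ge i k with hi | hi
    · rw [replacePrefix_of_lt _ _ hi, hy i (lt_max_of_lt_left hi), replacePrefix_of_lt _ _ hi]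
    · rw [replacePrefix_of_le _ _ hi]
  rw [← hyr]
  refine hn (PiNat.mem_cylinder_iff.2 fun i hi => ?_)
  rcases lt_or_ge i k with hik | hik
  · rw [replacePrefix_of_lt _ _ hik]
  · rw [replacePrefix_of_le _ _ hik, hy i (lt_max_of_lt_right hi), replacePrefix_of_le _ _ hik]

end Prefix

/-! ### Tails of series and the weak triangle inequality for `q`-th powers -/

theorem Summable.eventually_sum_Ico_le {f : ℕ → ℝ} (hf : Summable f) (h0 : ∀ n, 0 ≤ f n) {ε : ℝ}
    (hε : 0 < ε) : ∀ᶠ l in atTop, ∀ M, ∑ m ∈ Finset.Ico l M, f m ≤ ε := by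
  filter_upwards [hf.hasSum.tendsto_sum_nat.eventually (lt_mem_nhds (sub_lt_self _ hε))]
    with l hl M
  rcases le_total l M with h | h
  · rw [Finset.sum_Ico_eq_sub _ h]
    have := hf.sum_le_tsum (Finset.range M) fun n _ => h0 n
    linarith
  · simp [Finset.Ico_eq_empty_of_le h, hε.le]

theorem dist_rpow_le {Y : Type*} [PseudoMetricSpace Y] {q : ℝ} (hq : 0 ≤ q) (x y z : Y) :
    dist x z ^ q ≤ 2 ^ q * (dist x y ^ q + dist y z ^ q) := by
  have h1 : dist x z ≤ 2 * max (dist x y) (dist y z) := by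
    have := dist_triangle x y z
    have := le_max_left (dist x y) (dist y z)
    have := le_max_right (dist x y) (dist y z)
    linarith
  have hx := Real.rpow_nonneg (dist_nonneg (x := x) (y := y)) q
  have hy := Real.rpow_nonneg (dist_nonneg (x := y) (y := z)) q
  calc dist x z ^ q ≤ (2 * max (dist x y) (dist y z)) ^ q :=
        Real.rpow_le_rpow dist_nonneg h1 hq
    _ = 2 ^ q * max (dist x y) (dist y z) ^ q :=
        Real.mul_rpow zero_le_two (le_max_of_le_left dist_nonneg)
    _ ≤ _ := by
        gcongr
        rcases max_choice (dist x y) (dist y z) with h | h <;> rw [h] <;> linarith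

theorem sum_dist_rpow_le {Y ι : Type*} [PseudoMetricSpace Y] {q : ℝ} (hq : 0 ≤ q) (s : Finset ι)
    (x y z : ι → Y) :
    ∑ m ∈ s, dist (x m) (z m) ^ q ≤
      2 ^ q * (∑ m ∈ s, dist (x m) (y m) ^ q + ∑ m ∈ s, dist (y m) (z m) ^ q) := by
  rw [← Finset.sum_add_distrib, Finset.mul_sum]
  exact Finset.sum_le_sum fun m _ => dist_rpow_le hq _ _ _

theorem sum_dist_rpow_nonneg {Y ι : Type*} [PseudoMetricSpace Y] {q : ℝ} (s : Finset ι)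
    (x y : ι → Y) : 0 ≤ ∑ m ∈ s, dist (x m) (y m) ^ q :=
  Finset.sum_nonneg fun _ _ => Real.rpow_nonneg dist_nonneg _

/-- For a Borel map `θ` that sends eventually equal sequences to `ℓ_q`-equivalent ones there is a
sequence `z` such that, for sequences that agree with `z` on the windows `[k, K k)`, the entries of
`θ` beyond `l k` nearly forget what happens before `k`, and the entries before `l k` nearly forget
what happens after `k`. -/
theorem exists_generic_windows {E : ℕ → Type*} [∀ n, TopologicalSpace (E n)]
    [∀ n, DiscreteTopology (E n)] [∀ n, Finite (E n)] [∀ n, Nonempty (E n)]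
    {Y : Type*} [PseudoMetricSpace Y] [SecondCountableTopology Y] {q : ℝ} (hq : 0 < q)
    {θ : (∀ n, E n) → ℕ → Y} (hθ : @Measurable _ _ (borel _) (borel _) θ)
    (hfin : ∀ x y : ∀ n, E n, (∀ᶠ i in atTop, x i = y i) →
      Summable fun m => dist (θ x m) (θ y m) ^ q) :
    ∃ (z : ∀ n, E n) (l K : ℕ → ℕ) (H : Set (∀ n, E n)),
      Monotone l ∧ (∀ k, k ≤ l k) ∧ (∀ k, k ≤ K k) ∧
      (∀ k, ∀ x ∈ H, ∀ y ∈ H, (∀ i, k ≤ i → i < K k → x i = z i) → (∀ i, k ≤ i → x i = y i) →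
        ∀ M, ∑ m ∈ Finset.Ico (l k) M, dist (θ x m) (θ y m) ^ q ≤ (1 / 2) ^ k) ∧
      (∀ k, ∀ x ∈ H, ∀ y ∈ H, (∀ i, k ≤ i → i < K k → x i = z i) →
        (∀ i, k ≤ i → i < K k → y i = z i) → (∀ i < k, x i = y i) →
        ∑ m ∈ Finset.range (l k), dist (θ x m) (θ y m) ^ q ≤ (1 / 2) ^ k) ∧
      (∀ x, (∃ᶠ k in atTop, ∀ i, k ≤ i → i < K k → x i = z i) → x ∈ H) := by
  let Z := ∀ n, E n
  -- Points where changing the first `k` entries barely affects `θ` from `l` on. There are finitely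
  -- many prefixes, so for fixed `k` these sets cover `Z`; each has the Baire property, hence is
  -- open modulo a meagre set.
  let A : ℕ → ℕ → Set Z := fun k l => {x | ∀ (r r' : ∀ i : Fin k, E i) (M : ℕ),
    ∑ m ∈ Finset.Ico l M, dist (θ (replacePrefix k r x) m) (θ (replacePrefix k r' x) m) ^ q ≤
      (1 / 2) ^ k}
  have hAmono : ∀ k l l', l ≤ l' → A k l ⊆ A k l' := by
    intro k l l' hll x hx r r' M
    refine le_trans (Finset.sum_le_sum_of_subset_of_nonneg
      (Finset.Ico_subset_Ico_left hll) fun _ _ _ => Real.rpow_nonneg dist_nonneg _) (hx r r' M)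
  have hAcover : ∀ k x, ∃ l, x ∈ A k l := by
    intro k x
    have : ∀ᶠ l in atTop, ∀ r r' : ∀ i : Fin k, E i, ∀ M, ∑ m ∈ Finset.Ico l M,
        dist (θ (replacePrefix k r x) m) (θ (replacePrefix k r' x) m) ^ q ≤ (1 / 2) ^ k := by
      refine eventually_all.2 fun r => eventually_all.2 fun r' => ?_
      refine (hfin _ _ ?_).eventually_sum_Ico_le (fun m => Real.rpow_nonneg dist_nonneg _)
        (by positivity)
      filter_upwards [eventually_ge_atTop k] with i hi
      rw [replacePrefix_of_le _ _ hi, replacePrefix_of_le _ _ hi]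
    exact this.exists
  have hAinv : ∀ k l x (r : ∀ i : Fin k, E i), x ∈ A k l → replacePrefix k r x ∈ A k l := by
    intro k l x r hx s s' M
    simp only [replacePrefix_replacePrefix]
    exact hx s s' M
  have hAU : ∀ k l, ∃ u : Set Z, IsOpen u ∧ A k l =ᵇ u := by
    intro k l
    borelize Z (ℕ → Y) Y
    refine MeasurableSet.residualEq_isOpen ?_
    have hm : ∀ (r : ∀ i : Fin k, E i) m, Measurable fun x : Z => θ (replacePrefix k r x) m :=
      fun r m => ((continuous_apply m).borel_measurable.comp hθ).comp
        (continuous_replacePrefix k r).borel_measurable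
    simp only [A, ofPred_forall]
    refine MeasurableSet.iInter fun r => MeasurableSet.iInter fun r' =>
      MeasurableSet.iInter fun M => measurableSet_le ?_ measurable_const
    exact Finset.measurable_sum _ fun m _ => ((hm r m).dist (hm r' m)).pow_const q
  choose U hUo hUe using hAU
  obtain ⟨R, hR, hRc⟩ := exists_mem_residual_continuousOn hθ
  have hres : ∀ᵇ x : Z, x ∈ R ∧ ∀ k l, x ∈ A k l ↔ x ∈ U k l :=
    Eventually.and hR (eventually_countable_forall.2 fun k =>
      eventually_countable_forall.2 fun l => (hUe k l).mem_iff)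
  obtain ⟨H, hHsub, hHG, hHd⟩ := mem_residual.1 hres
  obtain ⟨O, hOo, hO⟩ := isGδ_iff_eq_iInter_nat.1 hHG
  have hHres : H ∈ residual Z := mem_residual.2 ⟨H, Subset.rfl, hHG, hHd⟩
  -- Countably many prefixes in all, so a generic `z` has all its finite modifications in `H`.
  have hz : ∀ᵇ z : Z, ∀ k (r : ∀ i : Fin k, E i), replacePrefix k r z ∈ H :=
    eventually_countable_forall.2 fun k => eventually_countable_forall.2 fun r =>
      (tendsto_residual_of_isOpenMap (continuous_replacePrefix k r)
        (isOpenMap_replacePrefix k r)).eventually hHres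
  obtain ⟨z, hz⟩ := (dense_of_mem_residual hz).nonempty
  replace hz : ∀ k (r : ∀ i : Fin k, E i), replacePrefix k r z ∈ H := hz
  choose l₀ hl₀ using fun k => hAcover k z
  let l : ℕ → ℕ := fun k => ∑ i ∈ Finset.range (k + 1), (l₀ i + 1)
  have hlmono : Monotone l := fun a b hab => Finset.sum_le_sum_of_subset (by gcongr)
  have hlge : ∀ k, k ≤ l k := fun k => by
    have : ∑ i ∈ Finset.range (k + 1), 1 ≤ l k := Finset.sum_le_sum fun i _ => by omega
    simp at this
    omega
  have hl₀l : ∀ k, l₀ k ≤ l k := fun k =>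
    le_trans (Nat.le_succ _) (Finset.single_le_sum (f := fun i => l₀ i + 1)
      (fun _ _ => Nat.zero_le _) (Finset.self_mem_range_succ k))
  have hzA : ∀ k, z ∈ A k (l k) := fun k => hAmono _ _ _ (hl₀l k) (hl₀ k)
  -- Two sequences are compared through a third, which costs `2 ^ q * (c k + c k) = (1 / 2) ^ k`.
  let c : ℕ → ℝ := fun k => (1 / 2) ^ k / (2 * 2 ^ q)
  have hc : ∀ k, 0 < c k := fun k => by positivity
  -- The window is long enough to force membership in `U k (l k)`, in the first `k` open sets
  -- defining `H`, and closeness of `θ` on its first `l k` entries. Matching infinitely many windows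
  -- therefore puts a sequence in `H`.
  have hK : ∀ k, ∃ K, k ≤ K ∧ ∀ r : ∀ i : Fin k, E i, ∀ x : Z,
      (∀ i < K, x i = replacePrefix k r z i) → x ∈ U k (l k) ∧ (∀ i < k, x ∈ O i) ∧
        (x ∈ H → ∑ m ∈ Finset.range (l k),
          dist (θ x m) (θ (replacePrefix k r z) m) ^ q ≤ c k) := by
    intro k
    have hev : ∀ᶠ K in atTop, ∀ r : ∀ i : Fin k, E i, ∀ x : Z,
      (∀ i < K, x i = replacePrefix k r z i) → x ∈ U k (l k) ∧ (∀ i < k, x ∈ O i) ∧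
        (x ∈ H → ∑ m ∈ Finset.range (l k),
          dist (θ x m) (θ (replacePrefix k r z) m) ^ q ≤ c k) := by
      refine eventually_all.2 fun r => ?_
      set w := replacePrefix k r z with hw
      have hwH : w ∈ H := hz k r
      have hwU : w ∈ U k (l k) := ((hHsub hwH).2 k (l k)).1 (hAinv _ _ _ _ (hzA k))
      have h1 : ∀ᶠ x in 𝓝 w, x ∈ U k (l k) := (hUo _ _).mem_nhds hwU
      have h2 : ∀ᶠ x in 𝓝 w, ∀ i < k, x ∈ O i := by
        refine (eventually_all_finite (finite_lt_nat k)).2 fun i _ => ?_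
        exact (hOo i).mem_nhds (mem_iInter.1 (hO ▸ hwH) i)
      have h3 : ∀ᶠ x in 𝓝 w, x ∈ H → ∑ m ∈ Finset.range (l k),
          dist (θ x m) (θ w m) ^ q ≤ c k := by
        have hcont : ContinuousWithinAt θ H w := (hRc w (hHsub hwH).1).mono fun x hx => (hHsub hx).1
        have hlim : Tendsto (fun x => ∑ m ∈ Finset.range (l k), dist (θ x m) (θ w m) ^ q)
            (𝓝[H] w) (𝓝 (∑ m ∈ Finset.range (l k), dist (θ w m) (θ w m) ^ q)) := by
          refine tendsto_finsetSum _ fun m _ => ?_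
          have hm : Tendsto (fun x => θ x m) (𝓝[H] w) (𝓝 (θ w m)) :=
            ((continuous_apply m).tendsto _).comp hcont
          exact (hm.dist tendsto_const_nhds).rpow_const (Or.inr hq.le)
        simp only [dist_self, Real.zero_rpow hq.ne', Finset.sum_const_zero] at hlim
        exact eventually_nhdsWithin_iff.1 (hlim.eventually (ge_mem_nhds (hc k)))
      obtain ⟨n, hn⟩ := exists_cylinder_subset_of_mem_nhds (h1.and (h2.and h3))
      filter_upwards [eventually_ge_atTop n] with K hK x hx
      exact hn (PiNat.mem_cylinder_iff.2 fun i hi => hx i (hi.trans_le hK))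
    exact ((eventually_ge_atTop k).and hev).exists
  choose K hkK hK using hK
  have hwin : ∀ k (x : Z), (∀ i, k ≤ i → i < K k → x i = z i) →
      ∀ i < K k, x i = replacePrefix k (fun i => x i) z i := by
    intro k x hx i hi
    rcases lt_or_ge i k with hik | hik
    · rw [replacePrefix_of_lt _ _ hik]
    · rw [replacePrefix_of_le _ _ hik, hx i hik hi]
  refine ⟨z, l, K, H, hlmono, hlge, hkK, ?_, ?_, ?_⟩
  · intro k x hx y _ hxz hxy M
    have hxU := (hK k _ x (hwin k x hxz)).1
    have hxA := ((hHsub hx).2 k (l k)).2 hxU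
    have := hxA (fun i => x i) (fun i => y i) M
    rwa [replacePrefix_eq (fun _ _ => rfl), replacePrefix_eq fun i hi => (hxy i hi).symm] at this
  · intro k x hx y hy hxz hyz hxy
    have h1 := (hK k _ x (hwin k x hxz)).2.2 hx
    have h2 := (hK k _ y (hwin k y hyz)).2.2 hy
    have hr : (fun i : Fin k => y i) = fun i : Fin k => x i := funext fun i => (hxy i i.2).symm
    rw [hr] at h2
    have h3 := sum_dist_rpow_le hq.le (Finset.range (l k)) (θ x)
      (θ (replacePrefix k (fun i => x i) z)) (θ y)
    simp only [dist_comm _ (θ y _)] at h3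
    have h2' : (0 : ℝ) < 2 ^ q := by positivity
    calc _ ≤ _ := by simpa only [dist_comm] using h3
      _ ≤ 2 ^ q * (c k + c k) := by
          gcongr
      _ = (1 / 2) ^ k := by simp only [c]; field_simp; ring
  · intro x hx
    rw [hO]
    refine mem_iInter.2 fun i => ?_
    obtain ⟨k, hk, hik⟩ := (hx.and_eventually (eventually_gt_atTop i)).exists
    exact (hK k _ x (hwin k x hk)).2.1 i hik

/-! ### Reductions that act blockwise -/

theorem sum_range_blocks (g : ℕ → ℝ) {L : ℕ → ℕ} (hL : Monotone L) (J : ℕ) :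
    ∑ m ∈ Finset.range (L J), g m = ∑ m ∈ Finset.range (L 0), g m +
      ∑ j ∈ Finset.range J, ∑ m ∈ Finset.Ico (L j) (L (j + 1)), g m := by
  induction J with
  | zero => simp
  | succ J ih =>
    rw [Finset.sum_range_succ, ← add_assoc, ← ih,
      Finset.sum_range_add_sum_Ico _ (hL (Nat.le_succ J))]

theorem summable_iff_summable_blocks {g : ℕ → ℝ} (hg : ∀ m, 0 ≤ g m) {L : ℕ → ℕ}
    (hL : Monotone L) (hLge : ∀ j, j ≤ L j) :
    Summable g ↔ Summable fun j => ∑ m ∈ Finset.Ico (L j) (L (j + 1)), g m := by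
  have hblock : ∀ j, 0 ≤ ∑ m ∈ Finset.Ico (L j) (L (j + 1)), g m :=
    fun j => Finset.sum_nonneg fun m _ => hg m
  constructor
  · intro h
    refine summable_of_sum_range_le (c := ∑' m, g m) hblock fun J => ?_
    have h1 := sum_range_blocks g hL J
    have h2 := h.sum_le_tsum (Finset.range (L J)) fun m _ => hg m
    have h3 : 0 ≤ ∑ m ∈ Finset.range (L 0), g m := Finset.sum_nonneg fun m _ => hg m
    linarith
  · intro h
    refine summable_of_sum_range_le (c := ∑ m ∈ Finset.range (L 0), g m +
      ∑' j, ∑ m ∈ Finset.Ico (L j) (L (j + 1)), g m) hg fun N => ?_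
    have h1 := sum_range_blocks g hL N
    have h2 := h.sum_le_tsum (Finset.range N) fun j _ => hblock j
    have h3 : ∑ m ∈ Finset.range N, g m ≤ ∑ m ∈ Finset.range (L N), g m :=
      Finset.sum_le_sum_of_subset_of_nonneg (Finset.range_subset_range.2 (hLge N))
        fun m _ _ => hg m
    linarith

/-- A Borel reduction of `finRel F p` to the `ℓ_q`-relation can be replaced, along a subsequence of
the coordinates, by one that acts separately on each coordinate. -/
theorem exists_blockwise_reduction {X Y : Type*} [MetricSpace X] [PseudoMetricSpace Y]
    [SecondCountableTopology Y] {F : ℕ → Set X} (hfin : ∀ n, (F n).Finite)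
    (hne : ∀ n, (F n).Nonempty) {p q : ℝ} (hp : 0 < p) (hq : 0 < q)
    (h : BorelReducible (finRel F p) (lpRel (fun _ : ℕ => Y) q)) :
    ∃ (n : ℕ → ℕ) (s : ℕ → Finset ℕ) (T : ℕ → X → ℕ → Y), StrictMono n ∧
      ∀ x y : ℕ → X, (∀ j, x j ∈ F (n j)) → (∀ j, y j ∈ F (n j)) →
        ((Summable fun j => dist (x j) (y j) ^ p) ↔
          Summable fun j => ∑ m ∈ s j, dist (T j (x j) m) (T j (y j) m) ^ q) := by
  classical
  obtain ⟨θ, hθ, hred⟩ := h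
  have : ∀ n, Finite (F n) := fun n => (hfin n).to_subtype
  have : ∀ n, Nonempty (F n) := fun n => (hne n).to_subtype
  obtain ⟨z, l, K, H, hlmono, hlge, hkK, htail, hhead, hH⟩ :=
    exists_generic_windows hq hθ fun x y hxy => (hred x y).1 <| by
      obtain ⟨N, hN⟩ := eventually_atTop.1 hxy
      refine summable_of_ne_finset_zero (s := Finset.range N) fun i hi => ?_
      rw [hN i (by simpa using hi), dist_self, Real.zero_rpow hp.ne']
  -- The window `[k j, K (k j))` is followed by exactly one free coordinate, `n j = K (k j)`, and
  -- the next window starts right after it.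
  obtain ⟨k, hksucc⟩ : ∃ k : ℕ → ℕ, ∀ j, k (j + 1) = K (k j) + 1 :=
    ⟨fun j => Nat.rec 0 (fun _ a => K a + 1) j, fun _ => rfl⟩
  let n : ℕ → ℕ := fun j => K (k j)
  replace hksucc : ∀ j, k (j + 1) = n j + 1 := hksucc
  have hkn : ∀ j, k j ≤ n j := fun j => hkK _
  have hk : StrictMono k := strictMono_nat_of_lt_succ fun j => by
    have := hkn j
    rw [hksucc]; omega
  have hn : StrictMono n := strictMono_nat_of_lt_succ fun j => by
    have := hkn (j + 1)
    rw [hksucc] at this; omega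
  have hnk : ∀ {i j}, i < j → n i < k j := fun {i j} hij => by
    have := hk.monotone (Nat.succ_le_of_lt hij)
    rw [Nat.succ_eq_add_one, hksucc] at this; omega
  have hwin : ∀ j i, k j ≤ i → i < K (k j) → i ∉ range n := by
    rintro j _ h1 h2 ⟨i, rfl⟩
    rcases lt_or_ge i j with hij | hij
    · exact absurd (hnk hij) (not_lt.2 h1)
    · exact absurd (hn.monotone hij) (not_le.2 h2)
  -- The value `z i` is also the default when the prescribed point is not in `F i`, so that `T j u`
  -- makes sense for every `u`.
  let pt : (ℕ → X) → ∀ i, F i := fun x i =>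
    if h : Function.extend n x (fun i => (z i : X)) i ∈ F i then ⟨_, h⟩ else z i
  have hpt : ∀ x j, x j ∈ F (n j) → (pt x (n j) : X) = x j := by
    intro x j hj
    simp only [pt, hn.injective.extend_apply, hj, dif_pos]
  have hptz : ∀ x i, i ∉ range n → pt x i = z i := by
    intro x i hi
    have he : Function.extend n x (fun i => (z i : X)) i = z i :=
      Function.extend_apply' _ _ _ hi
    simp [pt, he]
  have hptc : ∀ x y j, x j = y j → pt x (n j) = pt y (n j) := by
    intro x y j hj
    simp only [pt, hn.injective.extend_apply, hj]
  have hptw : ∀ x j i, k j ≤ i → i < K (k j) → pt x i = z i :=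
    fun x j i h1 h2 => hptz x i (hwin j i h1 h2)
  have hptH : ∀ x, pt x ∈ H := fun x => hH _ <|
    hk.tendsto_atTop.frequently (Frequently.of_forall fun j => hptw x j)
  let z' : ℕ → X := fun j => z (n j)
  let T : ℕ → X → ℕ → Y := fun j u => θ (pt (Function.update z' j u))
  let s : ℕ → Finset ℕ := fun j => Finset.Ico (l (k j)) (l (k (j + 1)))
  have hhalf : ∀ i j : ℕ, j ≤ i → (1 / 2 : ℝ) ^ i ≤ (1 / 2) ^ j := fun i j hij =>
    pow_le_pow_of_le_one (by norm_num) (by norm_num) hij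
  have herr : ∀ x j, ∑ m ∈ s j, dist (θ (pt x) m) (T j (x j) m) ^ q ≤
      2 ^ q * ((1 / 2) ^ j + (1 / 2) ^ j) := by
    intro x j
    -- The hybrid `b` shares its past with `x` up to index `j`, so window `j + 1` compares them; it
    -- shares its future from index `j` on with the sequence defining `T j (x j)`, so window `j`
    -- compares those.
    let b : ℕ → X := fun i => if i ≤ j then x i else z' i
    refine (sum_dist_rpow_le hq.le _ _ (θ (pt b)) _).trans ?_
    gcongr
    · refine le_trans (Finset.sum_le_sum_of_subset_of_nonneg (t := Finset.range (l (k (j + 1))))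
        (fun m hm => ?_) fun _ _ _ => Real.rpow_nonneg dist_nonneg _) <|
        (hhead (k (j + 1)) _ (hptH x) _ (hptH b) (hptw x (j + 1)) (hptw b (j + 1)) fun i hi => ?_).trans
          (hhalf _ _ ((Nat.le_succ j).trans (hk.le_apply)))
      · exact Finset.mem_range.2 (Finset.mem_Ico.1 hm).2
      · by_cases hin : i ∈ range n
        · obtain ⟨i, rfl⟩ := hin
          have hij : i ≤ j := by
            by_contra hij
            have := (hkn (j + 1)).trans (hn.monotone (not_le.1 hij))
            omega
          exact hptc _ _ _ (by simp [b, hij])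
        · rw [hptz _ _ hin, hptz _ _ hin]
    · refine (htail (k j) _ (hptH b) _ (hptH _) (hptw b j) (fun i hi => ?_) _).trans
        (hhalf _ _ hk.le_apply)
      by_cases hin : i ∈ range n
      · obtain ⟨i, rfl⟩ := hin
        have hij : j ≤ i := by
          by_contra hij
          have := hnk (not_le.1 hij)
          omega
        refine hptc _ _ _ ?_
        rcases hij.eq_or_lt with rfl | hij
        · simp [b]
        · simp [b, hij.not_ge, hij.ne']
      · rw [hptz _ _ hin, hptz _ _ hin]
  have hgeom : Summable fun j : ℕ => 2 ^ q * ((1 / 2 : ℝ) ^ j + (1 / 2) ^ j) :=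
    (summable_geometric_two.add summable_geometric_two).mul_left _
  have herrs : ∀ x, Summable fun j => ∑ m ∈ s j, dist (θ (pt x) m) (T j (x j) m) ^ q := fun x =>
    hgeom.of_nonneg_of_le (fun j => sum_dist_rpow_nonneg _ _ _) (herr x)
  have herrs' : ∀ x, Summable fun j => ∑ m ∈ s j, dist (T j (x j) m) (θ (pt x) m) ^ q :=
    fun x => (herrs x).congr fun j => Finset.sum_congr rfl fun m _ => by rw [dist_comm]
  have htri : ∀ f g h i : ℕ → ℕ → Y,
      (Summable fun j => ∑ m ∈ s j, dist (f j m) (g j m) ^ q) →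
      (Summable fun j => ∑ m ∈ s j, dist (g j m) (h j m) ^ q) →
      (Summable fun j => ∑ m ∈ s j, dist (h j m) (i j m) ^ q) →
      Summable fun j => ∑ m ∈ s j, dist (f j m) (i j m) ^ q := by
    intro f g h i h1 h2 h3
    have h12 := ((h1.add h2).mul_left (2 ^ q)).of_nonneg_of_le
      (fun j => sum_dist_rpow_nonneg _ _ _)
      fun j => sum_dist_rpow_le hq.le (s j) (f j) (g j) (h j)
    exact ((h12.add h3).mul_left (2 ^ q)).of_nonneg_of_le
      (fun j => sum_dist_rpow_nonneg _ _ _)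
      fun j => sum_dist_rpow_le hq.le (s j) (f j) (h j) (i j)
  refine ⟨n, s, T, hn, fun x y hx hy => ?_⟩
  have h1 : (Summable fun j => dist (x j) (y j) ^ p) ↔ finRel F p (pt x) (pt y) := by
    unfold finRel lpRel
    have hoff : ∀ i ∉ range n, dist (pt x i) (pt y i) ^ p = 0 := fun i hi => by
      rw [hptz x i hi, hptz y i hi, dist_self, Real.zero_rpow hp.ne']
    rw [← hn.injective.summable_iff hoff]
    refine summable_congr fun j => ?_
    simp only [Function.comp_apply, Subtype.dist_eq, hpt x j (hx j), hpt y j (hy j)]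
  rw [h1, hred]
  unfold lpRel
  rw [summable_iff_summable_blocks (L := fun j => l (k j))
    (fun m => Real.rpow_nonneg dist_nonneg _) (hlmono.comp hk.monotone)
    fun j => hk.le_apply.trans (hlge _)]
  constructor
  · exact fun h => htri _ (fun _ => θ (pt x)) (fun _ => θ (pt y)) _ (herrs' x) h (herrs y)
  · exact fun h => htri (fun _ => θ (pt x)) (fun j => T j (x j)) (fun j => T j (y j))
      (fun _ => θ (pt y)) (herrs x) h (herrs' y)

/-! ### From blockwise reductions to finite Hölder embeddings -/

theorem exists_disjoint_finsets {P : ℕ → ℕ → Prop} (hP : ∀ k, ∃ᶠ j in atTop, P k j)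
    (M : ℕ → ℕ) : ∃ S : ℕ → Finset ℕ, (∀ k, (S k).card = M k) ∧
      Pairwise (Function.onFun Disjoint S) ∧ ∀ k, ∀ j ∈ S k, k ≤ j ∧ P k j := by
  have hs : ∀ k N, ∃ s : Finset ℕ, s.card = M k ∧ ∀ j ∈ s, N ≤ j ∧ P k j := by
    intro k N
    have hinf : {j | N ≤ j ∧ P k j}.Infinite :=
      Nat.frequently_atTop_iff_infinite.1 ((hP k).and_eventually (eventually_ge_atTop N) |>.mono
        fun j hj => ⟨hj.2, hj.1⟩)
    obtain ⟨s, hs, hc⟩ := hinf.exists_subset_card_eq (M k)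
    exact ⟨s, hc, fun j hj => hs hj⟩
  choose s hcard hs using hs
  obtain ⟨N, hN⟩ : ∃ N : ℕ → ℕ, ∀ k, N (k + 1) = N k + 1 + (s k (N k)).sup id :=
    ⟨fun k => Nat.rec 0 (fun k a => a + 1 + (s k a).sup id) k, fun _ => rfl⟩
  have hNmono : StrictMono N := strictMono_nat_of_lt_succ fun k => by rw [hN]; omega
  have hlt : ∀ k, ∀ j ∈ s k (N k), j < N (k + 1) := fun k j hj => by
    have : id j ≤ (s k (N k)).sup id := Finset.le_sup hj
    rw [hN]
    simp only [id] at this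
    omega
  refine ⟨fun k => s k (N k), fun k => hcard k _, ?_, fun k j hj =>
    ⟨hNmono.le_apply.trans (hs k _ j hj).1, (hs k _ j hj).2⟩⟩
  refine (pairwise_disjoint_on _).2 fun i k hik => ?_
  refine Finset.disjoint_left.2 fun j hji hjk => ?_
  have h1 := hlt i j hji
  have h2 := hNmono.monotone (Nat.succ_le_of_lt hik)
  have h3 := (hs k _ j hjk).1
  simp only [Nat.succ_eq_add_one] at h2
  omega

/-- Since `k ≤ j` on `S k`, the terms below `n` that do not vanish lie in the sets `S k` with `k <
n`. -/
theorem summable_of_disjoint_finsets {g c : ℕ → ℝ} (hg : ∀ j, 0 ≤ g j) {S : ℕ → Finset ℕ}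
    (hS : Pairwise (Function.onFun Disjoint S)) (hle : ∀ k, ∀ j ∈ S k, k ≤ j)
    (hoff : ∀ j, (∀ k, j ∉ S k) → g j = 0) (hc : Summable c)
    (hgc : ∀ k, ∑ j ∈ S k, g j ≤ c k) : Summable g := by
  classical
  have hc0 : ∀ k, 0 ≤ c k := fun k => (Finset.sum_nonneg fun j _ => hg j).trans (hgc k)
  refine summable_of_sum_range_le (c := ∑' k, c k) hg fun n => ?_
  calc ∑ j ∈ Finset.range n, g j ≤ ∑ j ∈ (Finset.range n).biUnion S, g j := by
        rw [← Finset.sum_filter_of_ne (p := fun j => ∃ k, j ∈ S k)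
          fun j _ hj => by by_contra h; exact hj (hoff j (not_exists.1 h))]
        refine Finset.sum_le_sum_of_subset_of_nonneg (fun j hj => ?_) fun j _ _ => hg j
        obtain ⟨hjn, k, hk⟩ := Finset.mem_filter.1 hj
        exact Finset.mem_biUnion.2
          ⟨k, Finset.mem_range.2 ((hle k j hk).trans_lt (Finset.mem_range.1 hjn)), hk⟩
    _ = ∑ k ∈ Finset.range n, ∑ j ∈ S k, g j :=
        Finset.sum_biUnion fun i _ j _ hij => hS hij
    _ ≤ ∑ k ∈ Finset.range n, c k := Finset.sum_le_sum fun k _ => hgc k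
    _ ≤ ∑' k, c k := hc.sum_le_tsum _ fun k _ => hc0 k

theorem not_summable_of_one_le_sum {g : ℕ → ℝ} (hg : ∀ j, 0 ≤ g j) {S : ℕ → Finset ℕ}
    (hle : ∀ k, ∀ j ∈ S k, k ≤ j) (h1 : ∀ k, 1 ≤ ∑ j ∈ S k, g j) : ¬ Summable g := by
  intro h
  obtain ⟨l, hl⟩ := (h.eventually_sum_Ico_le hg one_half_pos).exists
  have := (h1 l).trans (Finset.sum_le_sum_of_subset_of_nonneg
    (t := Finset.Ico l ((S l).sup id + 1)) (fun j hj => Finset.mem_Ico.2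
      ⟨hle l j hj, Nat.lt_succ_of_le (Finset.le_sup (f := id) hj)⟩) fun j _ _ => hg j)
  linarith [hl ((S l).sup id + 1)]

/-! ### Uniform estimates by repetition of bad pairs -/

section Blockwise

variable {X : Type*} {V : ℕ → Set X} {D : Set X}

/-- Repeating each pair `(u k, v k)` `M k` times, on disjoint sets of coordinates, one cannot make
the sum of `g` finite and the sum of `h` infinite if finiteness of the former implies finiteness of
the latter. -/
theorem false_of_repeated_pairs (hV : ∀ j, (V j).Nonempty) (hD : ∀ u ∈ D, ∀ᶠ j in atTop, u ∈ V j)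
    {g h : ℕ → X → X → ℝ} (hg : ∀ j u v, 0 ≤ g j u v) (hg0 : ∀ j u, g j u u = 0)
    (hh : ∀ j u v, 0 ≤ h j u v)
    (hgh : ∀ x y : ℕ → X, (∀ j, x j ∈ V j) → (∀ j, y j ∈ V j) →
      (Summable fun j => g j (x j) (y j)) → Summable fun j => h j (x j) (y j))
    {u v : ℕ → X} (hu : ∀ k, u k ∈ D) (hv : ∀ k, v k ∈ D) {M : ℕ → ℕ} {c : ℕ → ℝ}
    (hc : Summable c)
    (hfreq : ∀ k, ∃ᶠ j in atTop, M k * g j (u k) (v k) ≤ c k ∧ 1 ≤ M k * h j (u k) (v k)) :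
    False := by
  classical
  obtain ⟨S, hcard, hdisj, hS⟩ := exists_disjoint_finsets
    (fun k => (hfreq k).and_eventually ((hD _ (hu k)).and (hD _ (hv k)))) M
  have hle : ∀ k, ∀ j ∈ S k, k ≤ j := fun k j hj => (hS k j hj).1
  have huniq : ∀ {j k l}, j ∈ S k → j ∈ S l → k = l := fun {j k l} hk hl => by
    by_contra hkl
    exact Finset.disjoint_left.1 (hdisj hkl) hk hl
  choose w hw using hV
  -- Off the sets `S k` both sequences take the same default value `w j`, so `g` vanishes there.
  let ext : (ℕ → X) → ℕ → X := fun u j => if hj : ∃ k, j ∈ S k then u hj.choose else w j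
  have hext : ∀ u k j, j ∈ S k → ext u j = u k := fun u k j hj => by
    have he : ∃ k, j ∈ S k := ⟨k, hj⟩
    simp only [ext, he, dif_pos]
    rw [huniq he.choose_spec hj]
  have hext' : ∀ u j, (∀ k, j ∉ S k) → ext u j = w j := fun u j hj => dif_neg (by simpa using hj)
  have hmem : ∀ u : ℕ → X, (∀ k, ∀ j ∈ S k, u k ∈ V j) → ∀ j, ext u j ∈ V j := by
    intro u hu j
    by_cases hj : ∃ k, j ∈ S k
    · obtain ⟨k, hk⟩ := hj
      rw [hext u k j hk]
      exact hu k j hk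
    · rw [hext' u j (not_exists.1 hj)]
      exact hw j
  have hM : ∀ k, 0 < (M k : ℝ) := fun k => by
    obtain ⟨j, -, hj⟩ := (hfreq k).exists
    rcases (Nat.cast_nonneg (α := ℝ) (M k)).eq_or_lt with h0 | h0
    · rw [← h0, zero_mul] at hj
      linarith
    · exact h0
  have hsum : Summable fun j => g j (ext u j) (ext v j) := by
    refine summable_of_disjoint_finsets (fun j => hg _ _ _) hdisj hle (fun j hj => ?_) hc fun k => ?_
    · rw [hext' u j hj, hext' v j hj, hg0]
    · calc ∑ j ∈ S k, g j (ext u j) (ext v j) ≤ ∑ j ∈ S k, c k / M k :=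
            Finset.sum_le_sum fun j hj => by
              rw [hext u k j hj, hext v k j hj, le_div_iff₀' (hM k)]
              exact (hS k j hj).2.1.1
        _ = M k * (c k / M k) := by rw [Finset.sum_const, hcard, nsmul_eq_mul]
        _ = c k := mul_div_cancel₀ _ (hM k).ne'
  refine not_summable_of_one_le_sum (fun j => hh _ _ _) hle (fun k => ?_)
    (hgh _ _ (hmem u fun k j hj => (hS k j hj).2.2.1) (hmem v fun k j hj => (hS k j hj).2.2.2) hsum)
  calc (1 : ℝ) = ∑ j ∈ S k, 1 / (M k : ℝ) := by
        rw [Finset.sum_const, hcard, nsmul_eq_mul, mul_one_div_cancel (hM k).ne']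
    _ ≤ _ := Finset.sum_le_sum fun j hj => by
        rw [hext u k j hj, hext v k j hj, div_le_iff₀' (hM k)]
        exact (hS k j hj).2.1.2

variable [MetricSpace X] {p : ℝ} {f : ℕ → X → X → ℝ}

/-- Repeat a bad pair `⌈1 / e k⌉₊` times, `e k` being its truncated `p`-th power: the truncated
distances contribute at least `1`, the `f j` at most `(1 / 2) ^ k * (1 + e k)`. Truncating at `C`
keeps `e k` bounded, so rounding up is harmless. -/
theorem exists_min_rpow_le (hV : ∀ j, (V j).Nonempty) (hD : ∀ u ∈ D, ∀ᶠ j in atTop, u ∈ V j)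
    (hp : 0 < p) (hf : ∀ j u v, 0 ≤ f j u v) (hf0 : ∀ j u, f j u u = 0)
    (hred : ∀ x y : ℕ → X, (∀ j, x j ∈ V j) → (∀ j, y j ∈ V j) →
      (Summable fun j => f j (x j) (y j)) → Summable fun j => dist (x j) (y j) ^ p)
    {C : ℝ} (hC : 0 < C) :
    ∃ B, ∀ u ∈ D, ∀ v ∈ D, ∀ᶠ j in atTop, min (dist u v) C ^ p ≤ B * f j u v := by
  by_contra! hB
  choose u hu v hv hfreq using fun k : ℕ => hB (2 ^ k)
  let e : ℕ → ℝ := fun k => min (dist (u k) (v k)) C ^ p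
  have hmin : ∀ a b : X, 0 ≤ min (dist a b) C := fun a b => le_min dist_nonneg hC.le
  have he : ∀ k, 0 < e k := fun k => by
    obtain ⟨j, hj⟩ := (hfreq k).exists
    exact (mul_nonneg (by positivity) (hf _ _ _)).trans_lt hj
  have heC : ∀ k, e k ≤ C ^ p := fun k => Real.rpow_le_rpow (hmin _ _) (min_le_right _ _) hp.le
  refine false_of_repeated_pairs hV hD (g := f) (h := fun _ a b => min (dist a b) C ^ p)
    (M := fun k => ⌈1 / e k⌉₊) (c := fun k => (1 / 2) ^ k * (1 + C ^ p)) hf hf0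
    (fun _ a b => Real.rpow_nonneg (hmin a b) _) (fun x y hx hy hs => ?_) hu hv
    (summable_geometric_two.mul_right _) fun k => (hfreq k).mono fun j hj => ⟨?_, ?_⟩
  · exact (hred x y hx hy hs).of_nonneg_of_le (fun j => Real.rpow_nonneg (hmin _ _) _)
      fun j => Real.rpow_le_rpow (hmin _ _) (min_le_left _ _) hp.le
  · have h1 : f j (u k) (v k) ≤ (1 / 2) ^ k * e k := by
      have h2 : (1 / 2 : ℝ) ^ k * (2 ^ k * f j (u k) (v k)) ≤ (1 / 2) ^ k * e k := by
        gcongr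
      rwa [← mul_assoc, ← mul_pow, one_div_mul_cancel two_ne_zero, one_pow, one_mul] at h2
    calc (⌈1 / e k⌉₊ : ℝ) * f j (u k) (v k) ≤ (1 / e k + 1) * ((1 / 2) ^ k * e k) := by
          have := he k
          gcongr
          · exact hf _ _ _
          · exact (Nat.ceil_lt_add_one (by positivity)).le
      _ = (1 / 2) ^ k * (1 + e k) := by
          have := (he k).ne'
          field_simp
      _ ≤ _ := by
          gcongr
          exact heC k
  · exact (div_le_iff₀ (he k)).1 (Nat.le_ceil _)

theorem exists_forall_dist_lt_eventually_le_one (hV : ∀ j, (V j).Nonempty)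
    (hD : ∀ u ∈ D, ∀ᶠ j in atTop, u ∈ V j) (hp : 0 < p) (hf : ∀ j u v, 0 ≤ f j u v)
    (hred : ∀ x y : ℕ → X, (∀ j, x j ∈ V j) → (∀ j, y j ∈ V j) →
      (Summable fun j => dist (x j) (y j) ^ p) → Summable fun j => f j (x j) (y j)) :
    ∃ ε > 0, ∀ u ∈ D, ∀ v ∈ D, dist u v < ε → ∀ᶠ j in atTop, f j u v ≤ 1 := by
  by_contra! hε
  choose u hu v hv hd hfreq using fun k : ℕ => hε (((1 / 2) ^ k) ^ p⁻¹) (by positivity)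
  refine false_of_repeated_pairs hV hD (g := fun _ a b => dist a b ^ p) (h := f)
    (M := fun _ => 1) (fun _ a b => Real.rpow_nonneg dist_nonneg _)
    (fun _ a => by rw [dist_self, Real.zero_rpow hp.ne']) hf hred hu hv summable_geometric_two
    fun k => (hfreq k).mono fun j hj => ⟨?_, ?_⟩
  · rw [Nat.cast_one, one_mul]
    have := Real.rpow_le_rpow dist_nonneg (hd k).le hp.le
    rwa [Real.rpow_inv_rpow (by positivity) hp.ne'] at this
  · rw [Nat.cast_one, one_mul]
    exact hj.le

/-- Link(C) joins `u` to `v` in a number `N` of short steps independent of the pair; each step costs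
at most `1`, and `N` weak triangle inequalities give the bound. -/
theorem exists_forall_dist_lt_eventually_le {C : ℝ} (hlink : Link X C) (hDd : Dense D) {Q ε : ℝ}
    (hQ : 0 ≤ Q) (hε : 0 < ε) (hf0 : ∀ j u, f j u u = 0)
    (hf3 : ∀ j u v w, f j u w ≤ Q * (f j u v + f j v w))
    (h1 : ∀ u ∈ D, ∀ v ∈ D, dist u v < ε → ∀ᶠ j in atTop, f j u v ≤ 1) :
    ∃ B, ∀ u ∈ D, ∀ v ∈ D, dist u v < C → ∀ᶠ j in atTop, f j u v ≤ B := by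
  classical
  -- One third for the step and one for moving each of its two ends into `D`; points already in `D`
  -- stay, so the chain keeps its endpoints.
  obtain ⟨N, -, hN⟩ := hlink (ε / 3) (by positivity)
  let b : ℕ → ℝ := fun i => Nat.rec 0 (fun _ a => Q * (a + 1)) i
  refine ⟨b N, fun u hu v hv huv => ?_⟩
  obtain ⟨r, hr0, hrN, hr⟩ := hN u v huv
  choose t ht hrt using fun i => hDd.exists_dist_lt (r i) (ε := ε / 3) (by positivity)
  let r' : ℕ → X := fun i => if r i ∈ D then r i else t i
  have hr'D : ∀ i, r' i ∈ D := fun i => by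
    by_cases h : r i ∈ D
    · simp [r', h]
    · simp [r', h, ht]
  have hr'r : ∀ i, dist (r i) (r' i) < ε / 3 := fun i => by
    by_cases h : r i ∈ D
    · simpa [r', h] using hε
    · simpa [r', h] using hrt i
  have hr'0 : r' 0 = u := by simp [r', hr0, hu]
  have hr'N : r' N = v := by simp [r', hrN, hv]
  have hstep : ∀ i < N, dist (r' i) (r' (i + 1)) < ε := fun i hi => by
    have h1 := dist_triangle4 (r' i) (r i) (r (i + 1)) (r' (i + 1))
    have h2 := hr'r i
    rw [dist_comm] at h2
    linarith [hr i hi, hr'r (i + 1)]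
  have hind : ∀ i ≤ N, ∀ᶠ j in atTop, f j u (r' i) ≤ b i := by
    intro i
    induction i with
    | zero =>
      intro _
      rw [hr'0]
      exact Eventually.of_forall fun j => (hf0 j u).le
    | succ i ih =>
      intro hi
      filter_upwards [ih (by omega), h1 _ (hr'D i) _ (hr'D (i + 1)) (hstep i hi)] with j h2 h3
      exact (hf3 j u (r' i) _).trans (mul_le_mul_of_nonneg_left (add_le_add h2 h3) hQ)
  simpa only [hr'N] using hind N le_rfl

/-- If `f j` exceeds `4 ^ k * t k` with `t k = d ^ p`, the bound `B₀` forces `t k ≤ (1 / 4) ^ k *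
B₀`. Then `⌈(1 / 2) ^ k / t k⌉₊` copies cost at most `(1 / 2) ^ k + t k`, which is summable, while
the `f j` contribute at least `2 ^ k`. -/
theorem exists_le_mul_dist_rpow (hV : ∀ j, (V j).Nonempty) (hD : ∀ u ∈ D, ∀ᶠ j in atTop, u ∈ V j)
    (hp : 0 < p) (hf : ∀ j u v, 0 ≤ f j u v) (hf0 : ∀ j u, f j u u = 0)
    (hred : ∀ x y : ℕ → X, (∀ j, x j ∈ V j) → (∀ j, y j ∈ V j) →
      (Summable fun j => dist (x j) (y j) ^ p) → Summable fun j => f j (x j) (y j))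
    {C B₀ : ℝ} (hB₀ : ∀ u ∈ D, ∀ v ∈ D, dist u v < C → ∀ᶠ j in atTop, f j u v ≤ B₀) :
    ∃ B, ∀ u ∈ D, ∀ v ∈ D, dist u v < C → ∀ᶠ j in atTop, f j u v ≤ B * dist u v ^ p := by
  by_contra! hB
  choose u hu v hv hd hfreq using fun k : ℕ => hB (4 ^ k)
  let t : ℕ → ℝ := fun k => dist (u k) (v k) ^ p
  have ht : ∀ k, 0 < t k := fun k => by
    obtain ⟨j, hj⟩ := (hfreq k).exists
    have hne : u k ≠ v k := fun h => by
      rw [h, hf0, dist_self, Real.zero_rpow hp.ne', mul_zero] at hj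
      exact lt_irrefl _ hj
    exact Real.rpow_pos_of_pos (dist_pos.2 hne) _
  have htB : ∀ k, t k ≤ (1 / 4) ^ k * B₀ := fun k => by
    obtain ⟨j, hj, hj'⟩ := ((hfreq k).and_eventually (hB₀ _ (hu k) _ (hv k) (hd k))).exists
    have h2 : (1 / 4 : ℝ) ^ k * (4 ^ k * t k) ≤ (1 / 4) ^ k * B₀ := by
      gcongr
      exact (hj.trans_le hj').le
    rwa [← mul_assoc, ← mul_pow, one_div_mul_cancel four_ne_zero, one_pow, one_mul] at h2
  refine false_of_repeated_pairs hV hD (g := fun _ a b => dist a b ^ p) (h := f)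
    (M := fun k => ⌈(1 / 2) ^ k / t k⌉₊) (c := fun k => (1 / 2) ^ k + (1 / 4) ^ k * B₀)
    (fun _ a b => Real.rpow_nonneg dist_nonneg _)
    (fun _ a => by rw [dist_self, Real.zero_rpow hp.ne']) hf hred hu hv
    (summable_geometric_two.add ((summable_geometric_of_lt_one (by norm_num)
      (by norm_num)).mul_right _)) fun k => (hfreq k).mono fun j hj => ⟨?_, ?_⟩
  · calc (⌈(1 / 2) ^ k / t k⌉₊ : ℝ) * t k ≤ ((1 / 2) ^ k / t k + 1) * t k := by
          have := ht k
          gcongr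
          exact (Nat.ceil_lt_add_one (by positivity)).le
      _ = (1 / 2) ^ k + t k := by
          have := (ht k).ne'
          field_simp
      _ ≤ _ := add_le_add_right (htB k) _
  · calc (1 : ℝ) ≤ 2 ^ k := one_le_pow₀ one_le_two
      _ = (1 / 2) ^ k / t k * (4 ^ k * t k) := by
          have := (ht k).ne'
          field_simp
          rw [← mul_pow]
          norm_num
      _ ≤ _ := by
          have := ht k
          gcongr
          · exact Nat.le_ceil _

end Blockwise

/-! ### Embedding a finite set by one block -/

theorem LqSpace.dist_rpow {Y : ℕ → Type*} [∀ n, PseudoMetricSpace (Y n)] {ystar : ∀ n, Y n}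
    {q : ℝ} [hq : Fact (1 ≤ q)] (x y : LqSpace Y ystar q) :
    dist x y ^ q = ∑' n, dist (x.1 n) (y.1 n) ^ q := by
  change ((∑' n, dist (x.1 n) (y.1 n) ^ q) ^ (1 / q)) ^ q = _
  rw [one_div, Real.rpow_inv_rpow (tsum_nonneg fun n => Real.rpow_nonneg dist_nonneg _)
    (by linarith [hq.out])]

theorem IsFiniteExhaustion.nonempty_apply {X : Type*} [TopologicalSpace X] {F : ℕ → Set X}
    (hF : IsFiniteExhaustion F) (n : ℕ) : (F n).Nonempty :=
  hF.nonempty.mono (hF.mono (Nat.zero_le n))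

/-- Two numbers are comparable if their `q`-th powers are. -/
theorem rpow_bounds_of_rpow_bounds {p q W d t : ℝ} (hq : 0 < q) (hW : 0 < W) (hd : 0 ≤ d)
    (ht : 0 ≤ t) (h1 : d ^ p ≤ W * t ^ q) (h2 : t ^ q ≤ W * d ^ p) :
    (W ^ q⁻¹)⁻¹ * d ^ (p / q) ≤ t ∧ t ≤ W ^ q⁻¹ * d ^ (p / q) := by
  have hdq : d ^ (p / q) = (d ^ p) ^ q⁻¹ := by rw [← Real.rpow_mul hd, div_eq_mul_inv]
  have htq : t = (t ^ q) ^ q⁻¹ := (Real.rpow_rpow_inv ht hq.ne').symm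
  have hdp : 0 ≤ d ^ p := Real.rpow_nonneg hd _
  have htp : 0 ≤ t ^ q := Real.rpow_nonneg ht _
  have hq' : 0 ≤ q⁻¹ := (inv_pos.2 hq).le
  have h3 := Real.rpow_le_rpow hdp h1 hq'
  have h4 := Real.rpow_le_rpow htp h2 hq'
  rw [Real.mul_rpow hW.le htp, ← htq, ← hdq] at h3
  rw [Real.mul_rpow hW.le hdp, ← htq, ← hdq] at h4
  exact ⟨(inv_mul_le_iff₀ (Real.rpow_pos_of_pos hW _)).2 h3, h4⟩

theorem finitelyHolderEmbeds_of_borelReducible {X Y : Type*} [MetricSpace X] [MetricSpace Y]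
    [SecondCountableTopology Y] {p q : ℝ} (hp : 0 < p) [hq : Fact (1 ≤ q)] {C : ℝ} (hC : 0 < C)
    (hX : Link X C) {F : ℕ → Set X} (hF : IsFiniteExhaustion F)
    (h : BorelReducible (finRel F p) (lpRel (fun _ : ℕ => Y) q)) (y₀ : Y) :
    FinitelyHolderEmbeds X (LqSpace (fun _ => Y) (fun _ => y₀) q) C (p / q) := by
  classical
  have hq0 : 0 < q := by linarith [hq.out]
  obtain ⟨n, s, T, hn, hred⟩ :=
    exists_blockwise_reduction hF.finite hF.nonempty_apply hp hq0 h
  let f : ℕ → X → X → ℝ := fun j u v => ∑ m ∈ s j, dist (T j u m) (T j v m) ^ q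
  have hf : ∀ j u v, 0 ≤ f j u v := fun j u v => sum_dist_rpow_nonneg _ _ _
  have hf0 : ∀ j u, f j u u = 0 := fun j u =>
    Finset.sum_eq_zero fun m _ => by rw [dist_self, Real.zero_rpow hq0.ne']
  have hV : ∀ j, (F (n j)).Nonempty := fun j => hF.nonempty_apply _
  have hD : ∀ u ∈ ⋃ i, F i, ∀ᶠ j in atTop, u ∈ F (n j) := fun u hu => by
    obtain ⟨i, hi⟩ := mem_iUnion.1 hu
    filter_upwards [eventually_ge_atTop i] with j hj
    exact hF.mono (hj.trans hn.le_apply) hi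
  obtain ⟨B₁, hB₁⟩ := exists_min_rpow_le hV hD hp hf hf0 (fun x y hx hy => (hred x y hx hy).2) hC
  obtain ⟨ε, hε, hfε⟩ := exists_forall_dist_lt_eventually_le_one hV hD hp hf
    fun x y hx hy => (hred x y hx hy).1
  obtain ⟨B₀, hB₀⟩ := exists_forall_dist_lt_eventually_le (f := f) hX hF.dense
    (Q := 2 ^ q) (by positivity) hε hf0 (fun j u v w => sum_dist_rpow_le hq0.le _ _ _ _) hfε
  obtain ⟨B₂, hB₂⟩ := exists_le_mul_dist_rpow hV hD hp hf hf0
    (fun x y hx hy => (hred x y hx hy).1) hB₀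
  let B := max 1 (max B₁ B₂)
  have hB1 : 1 ≤ B := le_max_left _ _
  have hB : 0 < B := by linarith
  have hB₁B : B₁ ≤ B := (le_max_left _ _).trans (le_max_right _ _)
  have hB₂B : B₂ ≤ B := (le_max_right _ _).trans (le_max_right _ _)
  have hW : 0 < 2 ^ p * B := by positivity
  -- Approximation in the dense set changes distances by a factor at most `2`, whence `2 ^ p`, and
  -- `C / 2` for pairs at distance at least `C`.
  refine ⟨(2 ^ p * B) ^ q⁻¹, ((C / 2) ^ p / B) ^ q⁻¹, by positivity, by positivity,
    fun P hP => ?_⟩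
  have : Finite P := hP.to_subtype
  choose a haD ha using fun u : P => mem_closure_iff_seq_limit.1 (hF.dense (u : X))
  have hdist : ∀ u v : P, Tendsto (fun i => dist (a u i) (a v i)) atTop (𝓝 (dist u v)) :=
    fun u v => (ha u).dist (ha v)
  have hi : ∀ᶠ i in atTop, ∀ u v : P, u ≠ v → dist u v / 2 ≤ dist (a u i) (a v i) ∧
      dist (a u i) (a v i) ≤ 2 * dist u v ∧ (dist u v < C → dist (a u i) (a v i) < C) := by
    refine eventually_all.2 fun u => eventually_all.2 fun v => ?_
    by_cases huv : u = v
    · simp [huv]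
    have hpos := dist_pos.2 huv
    have hlt : ∀ᶠ i in atTop, dist u v < C → dist (a u i) (a v i) < C := by
      by_cases h : dist u v < C
      · filter_upwards [(hdist u v).eventually (gt_mem_nhds h)] with i hi _ using hi
      · simp [h]
    filter_upwards [(hdist u v).eventually (le_mem_nhds (half_lt_self hpos)),
      (hdist u v).eventually (ge_mem_nhds (by linarith : dist u v < 2 * dist u v)), hlt]
      with i h1 h2 h3 _ using ⟨h1, h2, h3⟩
  obtain ⟨i, hi⟩ := hi.exists
  let b : P → X := fun u => a u i
  have hj : ∀ᶠ j in atTop, ∀ u v : P, min (dist (b u) (b v)) C ^ p ≤ B₁ * f j (b u) (b v) ∧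
      (dist (b u) (b v) < C → f j (b u) (b v) ≤ B₂ * dist (b u) (b v) ^ p) := by
    refine eventually_all.2 fun u => eventually_all.2 fun v =>
      (hB₁ _ (haD u i) _ (haD v i)).and ?_
    by_cases h : dist (b u) (b v) < C
    · filter_upwards [hB₂ _ (haD u i) _ (haD v i) h] with j hj _ using hj
    · simp [h]
  obtain ⟨j, hj⟩ := hj.exists
  let S : P → LqSpace (fun _ => Y) (fun _ => y₀) q := fun u =>
    ⟨fun m => if m ∈ s j then T j (b u) m else y₀,
      summable_of_ne_finset_zero (s := s j) fun m hm => by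
        simp [hm, Real.zero_rpow hq0.ne']⟩
  have hS : ∀ u v, dist (S u) (S v) ^ q = f j (b u) (b v) := fun u v => by
    rw [LqSpace.dist_rpow, tsum_eq_sum (s := s j) fun m hm => by
      simp [S, hm, Real.zero_rpow hq0.ne']]
    exact Finset.sum_congr rfl fun m hm => by simp [S, hm]
  refine ⟨S, fun u v => ?_⟩
  rcases eq_or_ne u v with rfl | huv
  · refine ⟨fun h => absurd h (by simpa using hC), fun _ => ?_⟩
    simp [Real.zero_rpow (div_pos hp hq0).ne']
  obtain ⟨h1, h2, h3⟩ := hi u v huv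
  obtain ⟨h4, h5⟩ := hj u v
  replace h4 : min (dist (b u) (b v)) C ^ p ≤ B * dist (S u) (S v) ^ q := by
    rw [hS]
    exact h4.trans (mul_le_mul_of_nonneg_right hB₁B (hf _ _ _))
  constructor
  · intro hCd
    have h6 : (C / 2) ^ p ≤ B * dist (S u) (S v) ^ q := by
      refine le_trans (Real.rpow_le_rpow (by positivity) (le_min ?_ (by linarith)) hp.le) h4
      linarith
    calc ((C / 2) ^ p / B) ^ q⁻¹ ≤ (dist (S u) (S v) ^ q) ^ q⁻¹ :=
          Real.rpow_le_rpow (by positivity) ((div_le_iff₀' hB).2 h6) (by positivity)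
      _ = dist (S u) (S v) := Real.rpow_rpow_inv dist_nonneg hq0.ne'
  · intro hCd
    have hbC := h3 hCd
    rw [min_eq_left hbC.le] at h4
    refine rpow_bounds_of_rpow_bounds hq0 hW dist_nonneg dist_nonneg ?_ ?_
    · calc dist u v ^ p ≤ (2 * dist (b u) (b v)) ^ p :=
            Real.rpow_le_rpow dist_nonneg (by linarith) hp.le
        _ = 2 ^ p * dist (b u) (b v) ^ p := Real.mul_rpow zero_le_two dist_nonneg
        _ ≤ 2 ^ p * (B * dist (S u) (S v) ^ q) := by gcongr
        _ = _ := by ring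
    · calc dist (S u) (S v) ^ q ≤ B₂ * dist (b u) (b v) ^ p := by rw [hS]; exact h5 hbC
        _ ≤ B * (2 * dist u v) ^ p := by
            gcongr
        _ = _ := by rw [Real.mul_rpow zero_le_two dist_nonneg]; ring

/-! ### From finite Hölder embeddings to reductions -/

theorem IsFiniteExhaustion.exists_tendsto {Y : Type*} [PseudoMetricSpace Y] {G : ℕ → Set Y}
    (hG : IsFiniteExhaustion G) (z : Y) :
    ∃ g : ℕ → Y, (∀ m, g m ∈ G m) ∧ Tendsto g atTop (𝓝 z) := by
  choose g hg hmin using fun m =>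
    Set.exists_min_image (G m) (fun w => dist w z) (hG.finite m) (hG.nonempty_apply m)
  refine ⟨g, hg, Metric.tendsto_atTop.2 fun ε hε => ?_⟩
  obtain ⟨w, hw, hwz⟩ := hG.dense.exists_dist_lt z hε
  obtain ⟨n, hn⟩ := mem_iUnion.1 hw
  refine ⟨n, fun m hm => (hmin m w (hG.mono hm hn)).trans_lt ?_⟩
  rwa [dist_comm]

/-- A finite family of pairwise `ℓ_q`-equivalent sequences can be replaced by sequences in a member
of a finite exhaustion, with comparable distances. -/
theorem IsFiniteExhaustion.exists_approx {Y ι : Type*} [MetricSpace Y] [Finite ι]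
    {G : ℕ → Set Y} (hG : IsFiniteExhaustion G) {q : ℝ} (hq : 0 < q) (T : ι → ℕ → Y)
    (hT : ∀ u v, Summable fun i => dist (T u i) (T v i) ^ q) :
    ∃ (m : ℕ) (S : ι → ℕ → Y), (∀ u i, S u i ∈ G m) ∧
      ∀ u v, (Summable fun i => dist (S u i) (S v i) ^ q) ∧
        ∑' i, dist (T u i) (T v i) ^ q ≤ 4 * ∑' i, dist (S u i) (S v i) ^ q ∧
        ∑' i, dist (S u i) (S v i) ^ q ≤ 4 * ∑' i, dist (T u i) (T v i) ^ q := by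
  classical
  choose g hgG hg using hG.exists_tendsto
  obtain ⟨y₀, hy₀⟩ := hG.nonempty
  let σ : ι → ι → ℝ := fun u v => ∑' i, dist (T u i) (T v i) ^ q
  have h0 : ∀ u v i, 0 ≤ dist (T u i) (T v i) ^ q := fun u v i => Real.rpow_nonneg dist_nonneg _
  have hσ0 : ∀ u v, 0 ≤ σ u v := fun u v => tsum_nonneg (h0 u v)
  have hK : ∀ᶠ K in atTop, ∀ u v, σ u v / 2 ≤ ∑ i ∈ Finset.range K, dist (T u i) (T v i) ^ q := by
    refine eventually_all.2 fun u => eventually_all.2 fun v => ?_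
    rcases (hσ0 u v).eq_or_lt with h | h
    · exact Eventually.of_forall fun K => by
        rw [← h, zero_div]
        exact Finset.sum_nonneg fun i _ => h0 u v i
    · exact (hT u v).hasSum.tendsto_sum_nat.eventually (le_mem_nhds (half_lt_self h))
  obtain ⟨K, hK⟩ := hK.exists
  have hm : ∀ᶠ m in atTop, ∀ u v,
      σ u v ≤ 4 * ∑ i ∈ Finset.range K, dist (g (T u i) m) (g (T v i) m) ^ q ∧
      ∑ i ∈ Finset.range K, dist (g (T u i) m) (g (T v i) m) ^ q ≤ 4 * σ u v := by
    refine eventually_all.2 fun u => eventually_all.2 fun v => ?_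
    rcases (hσ0 u v).eq_or_lt with h | h
    -- At distance `0` no error is allowed; there is none, because the approximant depends only on
    -- the point approximated.
    · have heq : ∀ i, T u i = T v i := fun i => by
        have h1 : dist (T u i) (T v i) ^ q ≤ σ u v := (hT u v).le_tsum i fun j _ => h0 u v j
        rw [← h] at h1
        exact dist_eq_zero.1 ((Real.rpow_eq_zero dist_nonneg hq.ne').1 (le_antisymm h1 (h0 u v i)))
      exact Eventually.of_forall fun m => by simp [heq, ← h, Real.zero_rpow hq.ne']
    · have hlim : Tendsto (fun m => ∑ i ∈ Finset.range K, dist (g (T u i) m) (g (T v i) m) ^ q)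
          atTop (𝓝 (∑ i ∈ Finset.range K, dist (T u i) (T v i) ^ q)) :=
        tendsto_finsetSum _ fun i _ => ((hg _).dist (hg _)).rpow_const (Or.inr hq.le)
      have hle : ∑ i ∈ Finset.range K, dist (T u i) (T v i) ^ q ≤ σ u v :=
        (hT u v).sum_le_tsum _ fun i _ => h0 u v i
      have hge := hK u v
      -- Truncation to `K` terms loses a factor at most `2`, approximation in `G m` another `2`.
      have hlt₁ : σ u v / 4 < ∑ i ∈ Finset.range K, dist (T u i) (T v i) ^ q := by linarith
      have hlt₂ : ∑ i ∈ Finset.range K, dist (T u i) (T v i) ^ q < 4 * σ u v := by linarith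
      filter_upwards [hlim.eventually (le_mem_nhds hlt₁), hlim.eventually (ge_mem_nhds hlt₂)]
        with m h1 h2
      exact ⟨by linarith, h2⟩
  obtain ⟨m, hm⟩ := hm.exists
  let S : ι → ℕ → Y := fun u i => if i ∈ Finset.range K then g (T u i) m else y₀
  have hoff : ∀ u v, ∀ i ∉ Finset.range K, dist (S u i) (S v i) ^ q = 0 := fun u v i hi => by
    simp only [S, if_neg hi, dist_self, Real.zero_rpow hq.ne']
  have hsum : ∀ u v, ∑' i, dist (S u i) (S v i) ^ q =
      ∑ i ∈ Finset.range K, dist (g (T u i) m) (g (T v i) m) ^ q := fun u v => by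
    rw [tsum_eq_sum (hoff u v)]
    exact Finset.sum_congr rfl fun i hi => by simp only [S, if_pos hi]
  refine ⟨m, S, fun u i => ?_, fun u v => ⟨summable_of_ne_finset_zero (hoff u v), ?_⟩⟩
  · by_cases hi : i ∈ Finset.range K
    · simp only [S, if_pos hi, hgG]
    · simp only [S, if_neg hi]
      exact hG.mono (Nat.zero_le m) hy₀
  · rw [hsum]
    exact hm u v

theorem borelReducible_of_finitelyHolderEmbeds {X Y : Type*} [MetricSpace X] [MetricSpace Y]
    {p q : ℝ} (hp : 0 < p) [hq : Fact (1 ≤ q)] {C : ℝ} (hC : 0 < C) {F : ℕ → Set X}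
    (hF : ∀ n, (F n).Finite) {G : ℕ → Set Y} (hG : IsFiniteExhaustion G) {ystar : ℕ → Y}
    (h : FinitelyHolderEmbeds X (LqSpace (fun _ => Y) ystar q) C (p / q)) :
    BorelReducible (finRel F p) (finRel G q) := by
  classical
  have hq0 : 0 < q := by linarith [hq.out]
  obtain ⟨A, D, hA, hD, h⟩ := h
  choose T hT using fun n => h (F n) (hF n)
  have : ∀ n, Finite (F n) := fun n => (hF n).to_subtype
  choose m S hSG hS hTS hST using fun n => hG.exists_approx hq0 (fun u => (T n u).1)
    fun u v => LqSpace.summable_dist hq.out (T n u) (T n v)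
  simp only [← LqSpace.dist_rpow] at hTS hST
  obtain ⟨y₀, hy₀⟩ := hG.nonempty
  let φ : ℕ → ℕ := fun n => ∑ i ∈ Finset.range (n + 1), (m i + 1)
  have hφ : StrictMono φ := strictMono_nat_of_lt_succ fun n => by
    simp only [φ, Finset.sum_range_succ _ (n + 1)]
    omega
  have hmφ : ∀ n, m n ≤ φ n := fun n => by
    simp only [φ, Finset.sum_range_succ]
    omega
  -- Pairing with `φ n ≥ m n` puts the `n`-th sequence at indices `j ≥ m n`, where `G (m n) ⊆ G j`.
  let e : ℕ × ℕ → ℕ := fun a => Nat.pair (φ a.1) a.2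
  have he : Function.Injective e := fun a b hab => by
    obtain ⟨h1, h2⟩ := Nat.pair_eq_pair.1 hab
    exact Prod.ext (hφ.injective h1) h2
  let val : (∀ n, F n) → ℕ → Y := fun x =>
    Function.extend e (fun a => S a.1 (x a.1) a.2) fun _ => y₀
  have hval : ∀ x a, val x (e a) = S a.1 (x a.1) a.2 := fun x a => he.extend_apply _ _ _
  have hval' : ∀ x, ∀ j ∉ range e, val x j = y₀ := fun x j hj => Function.extend_apply' _ _ _ hj
  have hmem : ∀ x j, val x j ∈ G j := fun x j => by
    by_cases hj : j ∈ range e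
    · obtain ⟨a, rfl⟩ := hj
      rw [hval]
      exact hG.mono ((hmφ _).trans (Nat.left_le_pair _ _)) (hSG _ _ _)
    · rw [hval' x j hj]
      exact hG.mono (Nat.zero_le j) hy₀
  refine ⟨fun x j => ⟨val x j, hmem x j⟩, Continuous.borel_measurable ?_, fun x y => ?_⟩
  · refine continuous_pi fun j => Continuous.subtype_mk ?_ _
    by_cases hj : j ∈ range e
    · obtain ⟨a, rfl⟩ := hj
      simp only [hval]
      exact (continuous_of_discreteTopology (f := fun u : F a.1 => S a.1 u a.2)).comp
        (continuous_apply a.1)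
    · simp only [hval' _ j hj]
      exact continuous_const
  let t : ℕ → ℝ := fun n => ∑' i, dist (S n (x n) i) (S n (y n) i) ^ q
  have ht0 : ∀ n, 0 ≤ t n := fun n => tsum_nonneg fun i => Real.rpow_nonneg dist_nonneg _
  have hd0 : ∀ n, 0 ≤ dist (x n) (y n) ^ p := fun n => Real.rpow_nonneg dist_nonneg _
  have h1 : finRel G q (fun j => ⟨val x j, hmem x j⟩) (fun j => ⟨val y j, hmem y j⟩) ↔
      Summable t := by
    have hoff : ∀ j ∉ range e, dist (val x j) (val y j) ^ q = 0 := fun j hj => by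
      rw [hval' x j hj, hval' y j hj, dist_self, Real.zero_rpow hq0.ne']
    change (Summable fun j => dist (val x j) (val y j) ^ q) ↔ _
    rw [← he.summable_iff hoff]
    have hcomp : (fun j => dist (val x j) (val y j) ^ q) ∘ e =
        fun a : ℕ × ℕ => dist (S a.1 (x a.1) a.2) (S a.1 (y a.1) a.2) ^ q :=
      funext fun a => by simp only [Function.comp_apply, hval]
    rw [hcomp, summable_prod_of_nonneg fun a => Real.rpow_nonneg dist_nonneg _]
    exact ⟨fun h => h.2, fun h => ⟨fun n => hS n (x n) (y n), h⟩⟩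
  rw [h1]
  have hpow : ∀ n, (dist (x n) (y n) ^ (p / q)) ^ q = dist (x n) (y n) ^ p := fun n => by
    rw [← Real.rpow_mul dist_nonneg, div_mul_cancel₀ _ hq0.ne']
  change (Summable fun n => dist (x n) (y n) ^ p) ↔ _
  constructor
  · intro hs
    refine Summable.of_norm_bounded_eventually_nat ((hs.mul_left (A ^ q)).mul_left 4) ?_
    filter_upwards [hs.tendsto_atTop_zero.eventually (gt_mem_nhds (Real.rpow_pos_of_pos hC p))]
      with n hn
    have hnC : dist (x n) (y n) < C := lt_of_not_ge fun hge =>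
      absurd (Real.rpow_le_rpow hC.le hge hp.le) (not_le.2 hn)
    rw [Real.norm_of_nonneg (ht0 n)]
    refine (hST n _ _).trans (mul_le_mul_of_nonneg_left ?_ (by norm_num))
    rw [← hpow, ← Real.mul_rpow hA.le (Real.rpow_nonneg dist_nonneg _)]
    exact Real.rpow_le_rpow dist_nonneg ((hT n _ _).2 hnC).2 hq0.le
  · intro hs
    refine Summable.of_norm_bounded_eventually_nat ((hs.mul_left 4).mul_left (A ^ q)) ?_
    -- The `4` absorbs the loss in `hTS`: a pair at distance at least `C` would have `t n ≥ D ^ q /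
    -- 4`.
    filter_upwards [hs.tendsto_atTop_zero.eventually
      (gt_mem_nhds (by positivity : 0 < D ^ q / 4))] with n hn
    have hTn := hTS n (x n) (y n)
    have hnC : dist (x n) (y n) < C := lt_of_not_ge fun hge => by
      have := Real.rpow_le_rpow hD.le ((hT n _ _).1 hge) hq0.le
      change t n < _ at hn
      linarith
    rw [Real.norm_of_nonneg (hd0 n)]
    refine le_trans ?_ (mul_le_mul_of_nonneg_left hTn (Real.rpow_nonneg hA.le _))
    rw [← hpow, ← Real.mul_rpow hA.le dist_nonneg]
    exact Real.rpow_le_rpow (Real.rpow_nonneg dist_nonneg _)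
      ((inv_mul_le_iff₀ hA).1 ((hT n _ _).2 hnC).1) hq0.le

/-- The relation on a finite exhaustion reduces to the one on the whole space. -/
theorem BorelReducible.of_finRel {Z Y : Type*} [TopologicalSpace Z] [PseudoMetricSpace Y]
    {R : Z → Z → Prop} {G : ℕ → Set Y} {q : ℝ} (h : BorelReducible R (finRel G q)) :
    BorelReducible R (lpRel (fun _ : ℕ => Y) q) := by
  obtain ⟨θ, hθ, hred⟩ := h
  refine ⟨fun x n => θ x n, ?_, hred⟩
  have hc : Continuous fun (x : ∀ n, G n) (n : ℕ) => (x n : Y) :=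
    continuous_pi fun n => continuous_subtype_val.comp (continuous_apply n)
  borelize Z (∀ n, G n) (ℕ → Y)
  exact hc.borel_measurable.comp hθ

theorem mainTheorem6 {X Y : Type*}
    [MetricSpace X] [CompleteSpace X] [TopologicalSpace.SeparableSpace X]
    [MetricSpace Y] [CompleteSpace Y] [TopologicalSpace.SeparableSpace Y]
    (p q : ℝ) (hp : 1 ≤ p) [hq : Fact (1 ≤ q)]
    (C : ℝ) (hC : 0 < C) (hX : Link X C)
    (F : ℕ → Set X) (hF : IsFiniteExhaustion F)
    (G : ℕ → Set Y) (hG : IsFiniteExhaustion G) :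
    List.TFAE [
      ∃ ystar : ℕ → Y, FinitelyHolderEmbeds X (LqSpace (fun _ => Y) ystar q) C (p / q),
      BorelReducible (finRel F p) (lpRel (fun _ => Y) q),
      BorelReducible (finRel F p) (finRel G q)] := by
  have hp0 : 0 < p := by linarith
  have : SecondCountableTopology Y := UniformSpace.secondCountable_of_separable Y
  tfae_have 1 → 3 := fun ⟨_, h⟩ => borelReducible_of_finitelyHolderEmbeds hp0 hC hF.finite hG h
  tfae_have 3 → 2 := BorelReducible.of_finRel
  tfae_have 2 → 1 := fun h =>
    ⟨fun _ => hG.nonempty.some, finitelyHolderEmbeds_of_borelReducible hp0 hC hX hF h _⟩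
  tfae_finish
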